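/- Let $n\in\{2,3,4\}$, let $\eta=\mathrm{diag}(-1,1,\dots,1)$ be the Minkowski metric of order $n$, and let $M$ be an invertible real $n\times n$ matrix. Call a real $n\times n$ matrix $\lambda$ a Lorentz matrix if $\lambda^{t}\eta\lambda=\eta$. Then $M$ can be written as $M=\lambda s$ with $\lambda$ a Lorentz matrix and $s$ a real symmetric $n\times n$ matrix if and only if the real matrix $\eta M^{t}\eta M$ has a real square root, i.e. there is a real $n\times n$ matrix $\gamma$ with $\gamma^{2}=\eta M^{t}\eta M$. -/

import Mathlib

/-- The Minkowski metric `η = diag(-1, 1, …, 1)` of order `n`. -/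
def minkowskiMetric (n : ℕ) : Matrix (Fin n) (Fin n) ℝ :=
  Matrix.diagonal fun i => if (i : ℕ) = 0 then -1 else 1

/-- A Lorentz matrix: a real matrix `lam` with `lamᵀ η lam = η` (no condition on the
determinant or on the time orientation). -/
def IsLorentz {n : ℕ} (lam : Matrix (Fin n) (Fin n) ℝ) : Prop :=
  lam.transpose * minkowskiMetric n * lam = minkowskiMetric n

/-- A real matrix `A` has a real square root. -/
def HasRealSquareRoot {n : ℕ} (A : Matrix (Fin n) (Fin n) ℝ) : Prop :=
  ∃ γ : Matrix (Fin n) (Fin n) ℝ, γ * γ = A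

/-!
Write `f(x, y) = xᵗ η y` and `A = η Mᵗ η M`, so that `f(x, A y) = f(M x, M y)`. If `M = λ s`, then
`A = (η s)²`. Conversely, a square root `B` of `A` that is self-adjoint for `f` gives the
decomposition `M = (M B⁻¹ η) (η B)` (`exists_lorentz_mul_symm`), so the point is to turn an
arbitrary real square root `γ` into a self-adjoint one (`exists_selfAdjoint_sqrt`).

If `A` has no eigenvalue in `(-∞, 0]`, it has a square root that is a polynomial in `A`
(`exists_aeval_mul_self_eq`), and polynomials in the self-adjoint `A` are self-adjoint.

Otherwise let `A x = -c x` with `c > 0`, `x ≠ 0`. The vectors `x` and `γ x` span a plane of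
eigenvectors. On this plane the pullback of `f` along `M` is `-c f`, and both forms are Lorentzian
on the whole space, hence take positive values on every plane; so `f` is indefinite on the plane,
which has a basis `u`, `v` with `f(u, u) = -1`, `f(v, v) = 1`, `f(u, v) = 0`
(`exists_lorentzian_eigenpair`). On the orthogonal complement both `f` and its pullback are positive
definite, so `A` has only positive eigenvalues there (`eigenvalue_pos_of_orthogonal`) and the
polynomial square root is available. On the plane itself the map `u ↦ -√c v`, `v ↦ √c u` is
self-adjoint precisely because the signature is `(1, 1)`, and it squares
to `-c`.
-/

/-! ### Square roots of `X` modulo a real polynomial -/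

open Polynomial in
/-- Conjugation-equivariant data on a conjugation-stable finite set of nodes are interpolated by
a polynomial with real coefficients. -/
theorem exists_real_interpolant (S : Finset ℂ) (r : ℂ → ℂ)
    (hS : ∀ z ∈ S, starRingEnd ℂ z ∈ S)
    (hr : ∀ z ∈ S, r (starRingEnd ℂ z) = starRingEnd ℂ (r z)) :
    ∃ p : ℝ[X], ∀ z ∈ S, aeval z p = r z := by
  classical
  have hinj : Set.InjOn (id : ℂ → ℂ) S := Function.injective_id.injOn
  -- Conjugating the coefficients of the complex interpolant gives another interpolant of the
  -- same data, so its coefficients are real by uniqueness.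
  have hconj : (Lagrange.interpolate S id r).map (starRingEnd ℂ) = Lagrange.interpolate S id r := by
    refine Lagrange.eq_interpolate_of_eval_eq r hinj ?_ fun z hz => ?_
    · rw [degree_map]
      exact Lagrange.degree_interpolate_lt r hinj
    · have h := eval_map_apply (p := Lagrange.interpolate S id r) (starRingEnd ℂ)
        (starRingEnd ℂ z)
      rw [Complex.conj_conj] at h
      have h' := Lagrange.eval_interpolate_at_node r hinj (hS z hz)
      simp only [id] at h' ⊢
      rw [h, h', hr z hz, Complex.conj_conj]
  obtain ⟨p, hp⟩ := (lifts_iff_coeff_lifts (f := algebraMap ℝ ℂ) _).2 fun k => by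
    have h := congrArg (fun q => coeff q k) hconj
    rw [coeff_map] at h
    exact ⟨_, Complex.conj_eq_iff_re.1 h⟩
  refine ⟨p, fun z hz => ?_⟩
  rw [coe_mapRingHom] at hp
  rw [aeval_def, ← eval_map, hp]
  exact Lagrange.eval_interpolate_at_node r hinj hz

open Polynomial in
/-- A real polynomial that vanishes at all complex roots of a monic `χ` has a power divisible
by `χ`. -/
theorem dvd_pow_of_aeval_eq_zero {χ q : ℝ[X]} (hχ : χ.Monic)
    (hq : ∀ z : ℂ, aeval z χ = 0 → aeval z q = 0) : ∃ k : ℕ, χ ∣ q ^ k := by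
  have hprod := (IsAlgClosed.splits (χ.map (algebraMap ℝ ℂ))).eq_prod_roots_of_monic (hχ.map _)
  have h := Multiset.prod_dvd_prod_of_dvd (S := (χ.map (algebraMap ℝ ℂ)).roots)
    (fun z => X - C z) (fun _ => q.map (algebraMap ℝ ℂ)) fun z hz => by
      rw [dvd_iff_isRoot, IsRoot, eval_map, ← aeval_def]
      refine hq z ?_
      rw [aeval_def, ← eval_map]
      exact isRoot_of_mem_roots hz
  rw [← hprod, Multiset.map_const', Multiset.prod_replicate, ← Polynomial.map_pow,
    map_dvd_map'] at h
  exact ⟨_, h⟩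

open Polynomial in
/-- The variable is a square modulo a monic real polynomial without roots on `(-∞, 0]`: the
principal square root is interpolated at the complex roots, and Newton's method corrects the
nilpotent error. -/
theorem exists_dvd_sq_sub_X {χ : ℝ[X]} (hχ : χ.Monic) (hroot : ∀ t : ℝ, χ.IsRoot t → 0 < t) :
    ∃ p : ℝ[X], χ ∣ p ^ 2 - X := by
  classical
  have hmem (z : ℂ) : z ∈ (χ.map (algebraMap ℝ ℂ)).roots.toFinset ↔ aeval z χ = 0 := by
    rw [Multiset.mem_toFinset, mem_roots ((hχ.map _).ne_zero), IsRoot, eval_map, aeval_def]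
  have hreal (z : ℂ) (hz : aeval z χ = 0) (him : z.im = 0) : 0 < z.re := by
    refine hroot _ ?_
    have hz' : z = algebraMap ℝ ℂ z.re := Complex.ext (by simp) (by simp [him])
    rw [hz', aeval_algebraMap_apply] at hz
    simpa using hz
  obtain ⟨p, hp⟩ := exists_real_interpolant (χ.map (algebraMap ℝ ℂ)).roots.toFinset
    (fun z => z ^ (1 / 2 : ℂ))
    (fun z hz => by
      rw [hmem] at hz ⊢
      rw [aeval_conj, hz, map_zero])
    (fun z hz => by
      rw [hmem] at hz
      have harg : z.arg ≠ Real.pi := fun h => by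
        obtain ⟨h1, h2⟩ := Complex.arg_eq_pi_iff.1 h
        linarith [hreal z hz h2]
      have hhalf : starRingEnd ℂ (1 / 2 : ℂ) = 1 / 2 := by
        rw [map_div₀, map_one, map_ofNat]
      rw [Complex.conj_cpow _ _ harg, hhalf])
  have hsq (z : ℂ) (hz : aeval z χ = 0) : aeval z p ^ 2 = z := by
    rw [hp z ((hmem z).2 hz), ← Complex.cpow_nat_mul]
    simp
  obtain ⟨k, hk⟩ := dvd_pow_of_aeval_eq_zero (q := p ^ 2 - X) hχ fun z hz => by
    simp [hsq z hz]
  have hcop : IsCoprime p χ := by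
    rw [isCoprime_iff_aeval_ne_zero_of_isAlgClosed ℝ ℂ]
    intro z
    by_contra! h
    have hz := hsq z h.2
    rw [h.1] at hz
    have := hreal z h.2 (by rw [← hz]; simp)
    rw [← hz] at this
    simp at this
  let π := Ideal.Quotient.mk (Ideal.span {χ})
  have hunit : IsUnit (π p) := by
    obtain ⟨a, b, hab⟩ := hcop
    refine IsUnit.of_mul_eq_one (π a) ?_
    have hχ0 : π χ = 0 := Ideal.Quotient.mk_singleton_self χ
    rw [mul_comm, ← map_mul, ← map_one π, ← hab, map_add, map_mul π b, hχ0, mul_zero, add_zero]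
  have hdvd (q : ℝ[X]) : π q = 0 ↔ χ ∣ q := by
    rw [Ideal.Quotient.eq_zero_iff_mem, Ideal.mem_span_singleton]
  have h2 : IsUnit (2 : ℝ[X] ⧸ Ideal.span {χ}) := by
    have := (isUnit_iff_ne_zero.2 (two_ne_zero (α := ℝ))).map
      (algebraMap ℝ (ℝ[X] ⧸ Ideal.span {χ}))
    rwa [map_ofNat] at this
  obtain ⟨r, ⟨-, hr⟩, -⟩ := existsUnique_nilpotent_sub_and_aeval_eq_zero
    (R := ℝ[X] ⧸ Ideal.span {χ}) (x := π p) (P := X ^ 2 - C (π X))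
    ⟨k, by
      have := (hdvd _).2 hk
      simpa using this⟩
    (by simpa [one_add_one_eq_two] using h2.mul hunit)
  obtain ⟨p', rfl⟩ := Ideal.Quotient.mk_surjective r
  refine ⟨p', (hdvd _).1 ?_⟩
  simpa using hr

open Polynomial in
/-- A real matrix without eigenvalues in `(-∞, 0]` has a square root that is a polynomial
in it. -/
theorem exists_aeval_mul_self_eq {n : Type*} [Fintype n] [DecidableEq n] (A : Matrix n n ℝ)
    (hA : ∀ (t : ℝ) (y : n → ℝ), t ≤ 0 → A.mulVec y = t • y → y = 0) :
    ∃ p : ℝ[X], aeval A p * aeval A p = A := by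
  obtain ⟨p, c, hc⟩ := exists_dvd_sq_sub_X A.charpoly_monic fun t ht => by
    by_contra! hle
    rw [IsRoot, Matrix.eval_charpoly, ← Matrix.exists_mulVec_eq_zero_iff] at ht
    obtain ⟨y, hy0, hy⟩ := ht
    refine hy0 (hA t y hle ?_)
    rw [Matrix.sub_mulVec, sub_eq_zero] at hy
    rw [← hy]
    ext i
    simp [Matrix.mulVec_diagonal]
  refine ⟨p, ?_⟩
  have h := congrArg (aeval A) hc
  rw [map_mul, Matrix.aeval_self_charpoly, zero_mul, map_sub, map_pow, aeval_X, sub_eq_zero,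
    sq] at h
  exact h

open Polynomial in
theorem mul_aeval_eq_aeval_mul {R S : Type*} [CommSemiring R] [Semiring S] [Algebra R S]
    {a x : S} (h : a * x = x * a) (p : R[X]) : a * aeval x p = aeval x p * a := by
  induction p using Polynomial.induction_on' with
  | add p q hp hq => rw [map_add, mul_add, add_mul, hp, hq]
  | monomial k c =>
    rw [aeval_monomial, ← mul_assoc, ← Algebra.commutes, mul_assoc, mul_assoc,
      ((Commute.pow_right (show Commute a x from h) k)).eq]

open Polynomial in
theorem transpose_aeval_mul_of_transpose_mul {n : Type*} [Fintype n] [DecidableEq n]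
    {A H : Matrix n n ℝ} (h : A.transpose * H = H * A) (p : ℝ[X]) :
    (aeval A p).transpose * H = H * aeval A p := by
  induction p using Polynomial.induction_on' with
  | add p q hp hq => rw [map_add, Matrix.transpose_add, mul_add, add_mul, hp, hq]
  | monomial k c =>
    have hk : (A ^ k).transpose * H = H * A ^ k := by
      rw [Matrix.transpose_pow]
      exact ((show SemiconjBy H A A.transpose from h.symm).pow_right k).symm
    rw [aeval_monomial, ← Algebra.smul_def, Matrix.transpose_smul, Matrix.smul_mul, hk,
      Matrix.mul_smul]

/-! ### Lorentzian geometry -/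

open Matrix

theorem minkowskiMetric_transpose (n : ℕ) : (minkowskiMetric n)ᵀ = minkowskiMetric n :=
  diagonal_transpose _

theorem minkowskiMetric_mul_self (n : ℕ) : minkowskiMetric n * minkowskiMetric n = 1 := by
  rw [minkowskiMetric, diagonal_mul_diagonal, ← diagonal_one]
  congr 1
  ext i
  split_ifs <;> norm_num

/-- The Minkowski bilinear form `xᵀ η y`. -/
def minkowskiForm {n : ℕ} (x y : Fin n → ℝ) : ℝ := x ⬝ᵥ (minkowskiMetric n *ᵥ y)

theorem minkowskiForm_comm {n : ℕ} (x y : Fin n → ℝ) :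
    minkowskiForm x y = minkowskiForm y x := by
  rw [minkowskiForm, minkowskiForm, dotProduct_mulVec, ← mulVec_transpose,
    minkowskiMetric_transpose, dotProduct_comm]

theorem minkowskiForm_smul_left {n : ℕ} (a : ℝ) (x y : Fin n → ℝ) :
    minkowskiForm (a • x) y = a * minkowskiForm x y := smul_dotProduct _ _ _

theorem minkowskiForm_smul_right {n : ℕ} (a : ℝ) (x y : Fin n → ℝ) :
    minkowskiForm x (a • y) = a * minkowskiForm x y := by
  rw [minkowskiForm_comm, minkowskiForm_smul_left, minkowskiForm_comm]

theorem minkowskiForm_succ {m : ℕ} (x y : Fin (m + 1) → ℝ) :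
    minkowskiForm x y = -(x 0 * y 0) + ∑ i : Fin m, x i.succ * y i.succ := by
  simp [minkowskiForm, minkowskiMetric, mulVec_diagonal, dotProduct, Fin.sum_univ_succ]

/-- The Minkowski adjoint `η Mᵗ η` of `M`, composed with `M`, represents the form pulled back
along `M`. -/
theorem minkowskiForm_gram_mulVec {n : ℕ} (M : Matrix (Fin n) (Fin n) ℝ) (x y : Fin n → ℝ) :
    minkowskiForm x ((minkowskiMetric n * Mᵀ * minkowskiMetric n * M) *ᵥ y) =
      minkowskiForm (M *ᵥ x) (M *ᵥ y) := by
  rw [minkowskiForm, minkowskiForm, mulVec_mulVec, mulVec_mulVec, ← mul_assoc, ← mul_assoc,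
    ← mul_assoc, minkowskiMetric_mul_self, one_mul, mul_assoc, ← mulVec_mulVec,
    dotProduct_mulVec, vecMul_transpose]

/-- A nonzero vector without time component is spacelike. -/
theorem minkowskiForm_self_pos_of_zero {m : ℕ} {x : Fin (m + 1) → ℝ} (hx : x ≠ 0)
    (h0 : x 0 = 0) : 0 < minkowskiForm x x := by
  rw [minkowskiForm_succ, h0, mul_zero, neg_zero, zero_add]
  have hnn (i : Fin m) : 0 ≤ x i.succ * x i.succ := mul_self_nonneg _
  refine lt_of_le_of_ne (Finset.sum_nonneg fun i _ => hnn i) fun h => hx ?_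
  rw [eq_comm, Finset.sum_eq_zero_iff_of_nonneg fun i _ => hnn i] at h
  ext i
  refine Fin.cases h0 (fun j => ?_) i
  exact mul_self_eq_zero.1 (h j (Finset.mem_univ j))

/-- Reverse Cauchy–Schwarz inequality: the orthogonal complement of a timelike vector is
spacelike. -/
theorem minkowskiForm_self_pos_of_orthogonal {m : ℕ} {u y : Fin (m + 1) → ℝ}
    (hu : minkowskiForm u u < 0) (huy : minkowskiForm u y = 0) (hy : y ≠ 0) :
    0 < minkowskiForm y y := by
  by_cases h0 : y 0 = 0
  · exact minkowskiForm_self_pos_of_zero hy h0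
  rw [minkowskiForm_succ] at hu huy ⊢
  have hcs := Finset.sum_mul_sq_le_sq_mul_sq Finset.univ (fun i : Fin m => u i.succ)
    fun i => y i.succ
  simp only [sq] at hcs
  set a := ∑ i : Fin m, u i.succ * u i.succ
  set b := ∑ i : Fin m, y i.succ * y i.succ
  set c := ∑ i : Fin m, u i.succ * y i.succ
  have hc : c = u 0 * y 0 := by linarith
  rw [hc] at hcs
  have ha : 0 ≤ a := Finset.sum_nonneg fun i _ => mul_self_nonneg _
  have hy2 : 0 < y 0 * y 0 := mul_self_pos.2 h0
  by_contra! hle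
  -- `u₀² y₀² ≤ a b ≤ a y₀² < u₀² y₀²`
  nlinarith [mul_le_mul_of_nonneg_left (show b ≤ y 0 * y 0 by linarith) ha,
    mul_lt_mul_of_pos_right (show a < u 0 * u 0 by linarith) hy2]

/-- A linear form has a nontrivial zero on the span of two independent vectors. -/
theorem exists_ne_zero_mem_span_pair {V : Type*} [AddCommGroup V] [Module ℝ V] {x z : V}
    (h : LinearIndependent ℝ ![x, z]) (φ : V →ₗ[ℝ] ℝ) :
    ∃ w ∈ Submodule.span ℝ {x, z}, w ≠ 0 ∧ φ w = 0 := by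
  by_cases hx : φ x = 0
  · exact ⟨x, Submodule.subset_span (by simp), h.ne_zero 0, hx⟩
  · refine ⟨φ z • x - φ x • z, ?_, fun h0 => ?_, ?_⟩
    · exact Submodule.mem_span_pair.2 ⟨φ z, -φ x, by rw [neg_smul, sub_eq_add_neg]⟩
    · rw [LinearIndependent.pair_iff] at h
      exact hx (neg_eq_zero.1 (h (φ z) (-φ x) (by rw [neg_smul, ← sub_eq_add_neg, h0])).2)
    · simp [mul_comm]

theorem minkowskiForm_normalize {n : ℕ} {x : Fin n → ℝ} {e : ℝ} (he : e * e = 1)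
    (hx : 0 < e * minkowskiForm x x) :
    ∃ a : ℝ, minkowskiForm (a • x) (a • x) = e := by
  refine ⟨(√(e * minkowskiForm x x))⁻¹, ?_⟩
  rw [minkowskiForm_smul_left, minkowskiForm_smul_right, ← mul_assoc, ← mul_inv,
    Real.mul_self_sqrt hx.le]
  have hm : minkowskiForm x x ≠ 0 := fun h => by simp [h] at hx
  have h0 : e ≠ 0 := fun h => by simp [h] at he
  field_simp
  rw [sq, he]

/-! ### Eigenvalues on the negative axis -/

/-- If `A = η Mᵗ η M` is a square and has a negative eigenvalue, then the eigenspace contains a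
Lorentzian plane. The plane is spanned by an eigenvector `x` and `γ x`, where `γ² = A`. On it,
both the Minkowski form and its pullback along `M` take positive values, and these two forms have
opposite signs there. -/
theorem exists_lorentzian_eigenpair {m : ℕ} {M γ : Matrix (Fin (m + 1)) (Fin (m + 1)) ℝ}
    (hM : IsUnit M)
    (hγ : γ * γ = minkowskiMetric (m + 1) * Mᵀ * minkowskiMetric (m + 1) * M)
    {c : ℝ} (hc : 0 < c) {x : Fin (m + 1) → ℝ} (hx0 : x ≠ 0)
    (hx : (minkowskiMetric (m + 1) * Mᵀ * minkowskiMetric (m + 1) * M) *ᵥ x = -c • x) :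
    ∃ u v : Fin (m + 1) → ℝ,
      (minkowskiMetric (m + 1) * Mᵀ * minkowskiMetric (m + 1) * M) *ᵥ u = -c • u ∧
      (minkowskiMetric (m + 1) * Mᵀ * minkowskiMetric (m + 1) * M) *ᵥ v = -c • v ∧
      minkowskiForm u u = -1 ∧ minkowskiForm v v = 1 ∧ minkowskiForm u v = 0 := by
  have hgram := minkowskiForm_gram_mulVec M
  set A := minkowskiMetric (m + 1) * Mᵀ * minkowskiMetric (m + 1) * M
  have hinj : Function.Injective M.mulVec := mulVec_injective_iff_isUnit.2 hM
  have hγx : A *ᵥ (γ *ᵥ x) = -c • (γ *ᵥ x) := by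
    rw [← hγ, ← mulVec_mulVec, mulVec_mulVec x, hγ, hx, mulVec_smul]
  have hind : LinearIndependent ℝ ![x, γ *ᵥ x] := by
    rw [LinearIndependent.pair_iff' hx0]
    intro t ht
    -- An eigenvalue `t` of `γ` would give `t² = -c < 0`.
    have h : A *ᵥ x = (t * t) • x := by
      rw [← hγ, ← mulVec_mulVec, ← ht, mulVec_smul, ← ht, smul_smul]
    rw [hx] at h
    have := smul_left_injective ℝ hx0 h
    nlinarith [mul_self_nonneg t]
  have heig {w : Fin (m + 1) → ℝ} (hw : w ∈ Submodule.span ℝ {x, γ *ᵥ x}) :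
      A *ᵥ w = -c • w := by
    obtain ⟨a, b, rfl⟩ := Submodule.mem_span_pair.1 hw
    rw [mulVec_add, mulVec_smul, mulVec_smul, hx, hγx, smul_add, smul_comm a, smul_comm b]
  obtain ⟨u, hu, hu0, hMu⟩ := exists_ne_zero_mem_span_pair hind
    (LinearMap.proj (0 : Fin (m + 1)) ∘ₗ M.mulVecLin)
  have huneg : minkowskiForm u u < 0 := by
    have h := minkowskiForm_self_pos_of_zero
      (fun h => hu0 (hinj (h.trans (mulVec_zero M).symm))) hMu
    rw [← hgram, heig hu, minkowskiForm_smul_right] at h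
    nlinarith
  obtain ⟨a, ha⟩ := minkowskiForm_normalize (e := -1) (by norm_num) (by linarith)
  obtain ⟨v, hv, hv0, huv⟩ := exists_ne_zero_mem_span_pair hind
    (Fintype.linearCombination ℝ (minkowskiMetric (m + 1) *ᵥ u))
  have hvu : minkowskiForm v u = 0 := huv
  have hvpos := minkowskiForm_self_pos_of_orthogonal huneg ((minkowskiForm_comm u v).trans hvu) hv0
  obtain ⟨b, hb⟩ := minkowskiForm_normalize (e := 1) (by norm_num) (by linarith)
  refine ⟨a • u, b • v, ?_, ?_, ha, hb, ?_⟩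
  · exact heig (Submodule.smul_mem _ _ hu)
  · exact heig (Submodule.smul_mem _ _ hv)
  · rw [minkowskiForm_smul_left, minkowskiForm_smul_right, minkowskiForm_comm, hvu, mul_zero,
      mul_zero]

/-- The operator `z ↦ f(y, z) x`, where `f` is the Minkowski form. -/
def minkowskiRankOne {n : ℕ} (x y : Fin n → ℝ) : Matrix (Fin n) (Fin n) ℝ :=
  vecMulVec x (minkowskiMetric n *ᵥ y)

theorem minkowskiRankOne_mul {n : ℕ} (x y z w : Fin n → ℝ) :
    minkowskiRankOne x y * minkowskiRankOne z w = minkowskiForm y z • minkowskiRankOne x w := by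
  rw [minkowskiRankOne, minkowskiRankOne, vecMulVec_mul_vecMulVec, vecMulVec_smul,
    minkowskiForm_comm, minkowskiForm, dotProduct_comm, minkowskiRankOne]

theorem minkowskiRankOne_mulVec {n : ℕ} (x y z : Fin n → ℝ) :
    minkowskiRankOne x y *ᵥ z = minkowskiForm y z • x := by
  rw [minkowskiRankOne, vecMulVec_mulVec, minkowskiForm_comm, minkowskiForm, dotProduct_comm]
  simp

theorem minkowskiRankOne_transpose_mul {n : ℕ} (x y : Fin n → ℝ) :
    (minkowskiRankOne x y)ᵀ * minkowskiMetric n = minkowskiMetric n * minkowskiRankOne y x := by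
  rw [minkowskiRankOne, minkowskiRankOne, transpose_vecMulVec, vecMulVec_mul, mul_vecMulVec,
    ← mulVec_transpose, minkowskiMetric_transpose]

theorem mul_minkowskiRankOne {n : ℕ} (A : Matrix (Fin n) (Fin n) ℝ) (x y : Fin n → ℝ) :
    A * minkowskiRankOne x y = minkowskiRankOne (A *ᵥ x) y := mul_vecMulVec _ _ _

theorem minkowskiRankOne_mul_of_selfAdjoint {n : ℕ} {A : Matrix (Fin n) (Fin n) ℝ}
    (hA : Aᵀ * minkowskiMetric n = minkowskiMetric n * A) (x y : Fin n → ℝ) :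
    minkowskiRankOne x y * A = minkowskiRankOne x (A *ᵥ y) := by
  rw [minkowskiRankOne, minkowskiRankOne, vecMulVec_mul, ← mulVec_transpose, mulVec_mulVec, hA,
    mulVec_mulVec]

theorem minkowskiRankOne_smul_left {n : ℕ} (a : ℝ) (x y : Fin n → ℝ) :
    minkowskiRankOne (a • x) y = a • minkowskiRankOne x y := smul_vecMulVec _ _ _

theorem minkowskiRankOne_smul_right {n : ℕ} (a : ℝ) (x y : Fin n → ℝ) :
    minkowskiRankOne x (a • y) = a • minkowskiRankOne x y := by
  rw [minkowskiRankOne, minkowskiRankOne, mulVec_smul, vecMulVec_smul]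

/-! ### Self-adjoint square roots -/

theorem minkowskiGram_transpose_mul {n : ℕ} (M : Matrix (Fin n) (Fin n) ℝ) :
    (minkowskiMetric n * Mᵀ * minkowskiMetric n * M)ᵀ * minkowskiMetric n =
      minkowskiMetric n * (minkowskiMetric n * Mᵀ * minkowskiMetric n * M) := by
  simp only [transpose_mul, transpose_transpose, minkowskiMetric_transpose]
  simp only [← mul_assoc, minkowskiMetric_mul_self, one_mul]
  simp only [mul_assoc, minkowskiMetric_mul_self, mul_one]

/-- On the orthogonal complement of a Lorentzian plane of eigenvectors with a negative eigenvalue,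
`A = η Mᵗ η M` has only positive eigenvalues: both the Minkowski form and its pullback along `M`
are positive definite there. -/
theorem eigenvalue_pos_of_orthogonal {m : ℕ} {M : Matrix (Fin (m + 1)) (Fin (m + 1)) ℝ}
    (hM : IsUnit M) {c : ℝ} (hc : 0 < c) {u v : Fin (m + 1) → ℝ}
    (hv : (minkowskiMetric (m + 1) * Mᵀ * minkowskiMetric (m + 1) * M) *ᵥ v = -c • v)
    (huu : minkowskiForm u u < 0) (hvv : 0 < minkowskiForm v v)
    {t : ℝ} {y : Fin (m + 1) → ℝ} (hy0 : y ≠ 0)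
    (hy : (minkowskiMetric (m + 1) * Mᵀ * minkowskiMetric (m + 1) * M) *ᵥ y = t • y)
    (huy : minkowskiForm u y = 0) (hvy : minkowskiForm v y = 0) : 0 < t := by
  have hypos := minkowskiForm_self_pos_of_orthogonal huu huy hy0
  have hMy0 : M *ᵥ y ≠ 0 := fun h =>
    hy0 (mulVec_injective_iff_isUnit.2 hM (h.trans (mulVec_zero M).symm))
  -- The image of the spacelike vector `v` is timelike.
  have hMv : minkowskiForm (M *ᵥ v) (M *ᵥ v) < 0 := by
    rw [← minkowskiForm_gram_mulVec, hv, minkowskiForm_smul_right]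
    nlinarith
  have hMvy : minkowskiForm (M *ᵥ v) (M *ᵥ y) = 0 := by
    rw [← minkowskiForm_gram_mulVec, hy, minkowskiForm_smul_right, hvy, mul_zero]
  have h := minkowskiForm_self_pos_of_orthogonal hMv hMvy hMy0
  rw [← minkowskiForm_gram_mulVec, hy, minkowskiForm_smul_right] at h
  exact pos_of_mul_pos_left h hypos.le

/-- If `A = η Mᵗ η M` has a real square root, then it has one that is self-adjoint for the
Minkowski form. -/
theorem exists_selfAdjoint_sqrt {m : ℕ} {M γ : Matrix (Fin (m + 1)) (Fin (m + 1)) ℝ}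
    (hM : IsUnit M)
    (hγ : γ * γ = minkowskiMetric (m + 1) * Mᵀ * minkowskiMetric (m + 1) * M) :
    ∃ B : Matrix (Fin (m + 1)) (Fin (m + 1)) ℝ,
      B * B = minkowskiMetric (m + 1) * Mᵀ * minkowskiMetric (m + 1) * M ∧
      Bᵀ * minkowskiMetric (m + 1) = minkowskiMetric (m + 1) * B := by
  have hsa := minkowskiGram_transpose_mul M
  have hpos := fun c hc u v => @eigenvalue_pos_of_orthogonal m M hM c hc u v
  have hpair := fun c hc x => @exists_lorentzian_eigenpair m M γ hM hγ c hc x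
  have hunit : IsUnit (minkowskiMetric (m + 1) * Mᵀ * minkowskiMetric (m + 1) * M) := by
    have hη : IsUnit (minkowskiMetric (m + 1)) :=
      IsUnit.of_mul_eq_one _ (minkowskiMetric_mul_self (m + 1))
    exact ((hη.mul ((isUnit_transpose M).2 hM)).mul hη).mul hM
  set A := minkowskiMetric (m + 1) * Mᵀ * minkowskiMetric (m + 1) * M
  set η := minkowskiMetric (m + 1)
  by_cases hneg : ∀ (t : ℝ) (y : Fin (m + 1) → ℝ), t ≤ 0 → A *ᵥ y = t • y → y = 0
  · obtain ⟨p, hp⟩ := exists_aeval_mul_self_eq A hneg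
    exact ⟨_, hp, transpose_aeval_mul_of_transpose_mul hsa p⟩
  push Not at hneg
  obtain ⟨t, x, ht, hx, hx0⟩ := hneg
  have ht' : t ≠ 0 := by
    rintro rfl
    rw [zero_smul] at hx
    exact hx0 (mulVec_injective_iff_isUnit.2 hunit (hx.trans (mulVec_zero A).symm))
  obtain ⟨c, rfl⟩ : ∃ c, t = -c := ⟨-t, (neg_neg t).symm⟩
  have hc : 0 < c := by linarith [lt_of_le_of_ne ht ht']
  obtain ⟨u, v, hu, hv, huu, hvv, huv⟩ := hpair c hc x hx0 hx
  have hvu : minkowskiForm v u = 0 := (minkowskiForm_comm v u).trans huv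
  -- `P` is the orthogonal projection onto the plane spanned by `u` and `v`; `J` is a self-adjoint
  -- complex structure on that plane, which exists because the plane is Lorentzian.
  obtain ⟨P, hP⟩ : ∃ P, P = minkowskiRankOne v v - minkowskiRankOne u u := ⟨_, rfl⟩
  obtain ⟨J, hJ⟩ : ∃ J, J = minkowskiRankOne v u + minkowskiRankOne u v := ⟨_, rfl⟩
  have hPP : P * P = P := by
    simp [hP, mul_sub, sub_mul, minkowskiRankOne_mul, huu, hvv, huv, hvu]
  have hJJ : J * J = -P := by
    simp [hP, hJ, mul_add, add_mul, minkowskiRankOne_mul, huu, hvv, huv, hvu]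
    abel
  have hPJ : P * J = J := by
    simp [hP, hJ, mul_add, sub_mul, minkowskiRankOne_mul, huu, hvv, huv, hvu]
  have hJP : J * P = J := by
    simp [hP, hJ, mul_sub, add_mul, minkowskiRankOne_mul, huu, hvv, huv, hvu]
    abel
  have hAP : A * P = -c • P := by
    rw [hP, mul_sub, mul_minkowskiRankOne, mul_minkowskiRankOne, hu, hv,
      minkowskiRankOne_smul_left, minkowskiRankOne_smul_left, smul_sub]
  have hPA : P * A = -c • P := by
    rw [hP, sub_mul, minkowskiRankOne_mul_of_selfAdjoint hsa,
      minkowskiRankOne_mul_of_selfAdjoint hsa, hu, hv,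
      minkowskiRankOne_smul_right, minkowskiRankOne_smul_right, smul_sub]
  have hPsa : Pᵀ * η = η * P := by
    rw [hP, transpose_sub, sub_mul, mul_sub, minkowskiRankOne_transpose_mul,
      minkowskiRankOne_transpose_mul]
  have hJsa : Jᵀ * η = η * J := by
    rw [hJ, transpose_add, add_mul, mul_add, minkowskiRankOne_transpose_mul,
      minkowskiRankOne_transpose_mul]
    exact add_comm _ _
  -- Replacing the eigenvalue `-c` by `1` on the plane leaves only positive eigenvalues.
  obtain ⟨A', hA'⟩ : ∃ A', A' = A + (c + 1) • P := ⟨_, rfl⟩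
  have hPA' : P * A' = P := by
    rw [hA', mul_add, hPA, mul_smul_comm, hPP]
    module
  have hA'P : A' * P = P := by
    rw [hA', add_mul, hAP, smul_mul_assoc, hPP]
    module
  have hA'sa : A'ᵀ * η = η * A' := by
    rw [hA', transpose_add, add_mul, mul_add, hsa, transpose_smul, smul_mul_assoc, hPsa,
      mul_smul_comm]
  obtain ⟨p, hp⟩ := exists_aeval_mul_self_eq A' fun t y ht hy => by
    by_contra hy0
    have hPy : P *ᵥ y = 0 := by
      have h : P *ᵥ y = t • P *ᵥ y := by
        rw [← mulVec_smul, ← hy, mulVec_mulVec, hPA']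
      have h1 : (1 - t) • P *ᵥ y = 0 := by rw [sub_smul, one_smul, ← h, sub_self]
      exact (smul_eq_zero.1 h1).resolve_left (by linarith)
    have hexp : minkowskiForm v y • v - minkowskiForm u y • u = 0 := by
      rw [← hPy, hP, sub_mulVec, minkowskiRankOne_mulVec, minkowskiRankOne_mulVec]
    have huy : minkowskiForm u y = 0 := by
      have h := congrArg (fun w => u ⬝ᵥ (η *ᵥ w)) hexp
      simp only [mulVec_sub, mulVec_smul, dotProduct_sub, dotProduct_smul, mulVec_zero,
        dotProduct_zero] at h
      change minkowskiForm v y • minkowskiForm u v - minkowskiForm u y • minkowskiForm u u = 0 at h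
      simpa [huu, huv] using h
    have hvy : minkowskiForm v y = 0 := by
      have h := congrArg (fun w => v ⬝ᵥ (η *ᵥ w)) hexp
      simp only [mulVec_sub, mulVec_smul, dotProduct_sub, dotProduct_smul, mulVec_zero,
        dotProduct_zero] at h
      change minkowskiForm v y • minkowskiForm v v - minkowskiForm u y • minkowskiForm v u = 0 at h
      simpa [hvv, hvu] using h
    rw [hA', add_mulVec, smul_mulVec, hPy, smul_zero, add_zero] at hy
    exact absurd (hpos c hc u v hv (by linarith) (by linarith) hy0 hy huy hvy) (not_lt.2 ht)
  obtain ⟨B, hB⟩ : ∃ B, B = Polynomial.aeval A' p := ⟨_, rfl⟩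
  have hPB : P * B = B * P := hB ▸ mul_aeval_eq_aeval_mul (hPA'.trans hA'P.symm) p
  have hBsa : Bᵀ * η = η * B := hB ▸ transpose_aeval_mul_of_transpose_mul hA'sa p
  rw [← hB] at hp
  -- `B` is a square root of `A` off the plane, and `√c J` is one on it.
  refine ⟨B * (1 - P) + √c • J, ?_, ?_⟩
  · have h1 : B * (1 - P) * (B * (1 - P)) = A + c • P := by
      have hcomm : (1 - P) * B = B * (1 - P) := by
        rw [sub_mul, mul_sub, hPB, one_mul, mul_one]
      have hidem : (1 - P) * (1 - P) = 1 - P := by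
        rw [sub_mul, one_mul, mul_sub, mul_one, hPP, sub_self, sub_zero]
      rw [mul_assoc, ← mul_assoc (1 - P), hcomm, mul_assoc, hidem, ← mul_assoc, hp, mul_sub,
        mul_one, hA'P, hA']
      module
    have h2 : B * (1 - P) * J = 0 := by
      rw [mul_assoc, sub_mul, hPJ, one_mul, sub_self, mul_zero]
    have h3 : J * (B * (1 - P)) = 0 := by
      rw [mul_sub, mul_one, ← hPB, ← hJP, mul_assoc, mul_sub, ← mul_assoc P P, hPP, sub_self,
        mul_zero]
    rw [add_mul, mul_add, mul_add, h1, mul_smul_comm, h2, smul_mul_assoc, h3, smul_mul_assoc,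
      mul_smul_comm, hJJ, smul_smul, Real.mul_self_sqrt hc.le]
    module
  · rw [transpose_add, transpose_smul, add_mul, mul_add, smul_mul_assoc, hJsa, mul_smul_comm,
      mul_sub, mul_one, ← hPB, transpose_sub, transpose_mul, sub_mul, hBsa, mul_assoc, hPsa,
      ← mul_assoc, hBsa, mul_assoc, hPB, mul_sub]

/-- An invertible `M` such that `η Mᵗ η M` has a self-adjoint square root `B` has the polar
decomposition `M = (M B⁻¹ η) (η B)`. -/
theorem exists_lorentz_mul_symm {n : ℕ} {M B : Matrix (Fin n) (Fin n) ℝ} (hM : IsUnit M)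
    (hB : B * B = minkowskiMetric n * Mᵀ * minkowskiMetric n * M)
    (hsa : Bᵀ * minkowskiMetric n = minkowskiMetric n * B) :
    ∃ lam s : Matrix (Fin n) (Fin n) ℝ, IsLorentz lam ∧ s.IsSymm ∧ M = lam * s := by
  have hηη := minkowskiMetric_mul_self n
  have hηt := minkowskiMetric_transpose n
  have hgram : Mᵀ * minkowskiMetric n * M = minkowskiMetric n * (B * B) := by
    rw [hB]
    simp only [← mul_assoc, hηη, one_mul]
  have hdet : IsUnit B.det := by
    have hη : IsUnit (minkowskiMetric n) := IsUnit.of_mul_eq_one _ hηη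
    have h : IsUnit (B * B) := hB ▸ ((hη.mul ((isUnit_transpose M).2 hM)).mul hη).mul hM
    rw [isUnit_iff_isUnit_det, det_mul] at h
    exact isUnit_of_mul_isUnit_left h
  have hinv : (B⁻¹)ᵀ * minkowskiMetric n * B = minkowskiMetric n := by
    rw [mul_assoc, ← hsa, ← mul_assoc, ← transpose_mul, mul_nonsing_inv B hdet, transpose_one,
      one_mul]
  refine ⟨M * B⁻¹ * minkowskiMetric n, minkowskiMetric n * B, ?_, ?_, ?_⟩
  · calc (M * B⁻¹ * minkowskiMetric n)ᵀ * minkowskiMetric n * (M * B⁻¹ * minkowskiMetric n)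
        = minkowskiMetric n * (B⁻¹)ᵀ * (Mᵀ * minkowskiMetric n * M) * B⁻¹ * minkowskiMetric n := by
          simp only [transpose_mul, hηt, mul_assoc]
      _ = minkowskiMetric n * ((B⁻¹)ᵀ * minkowskiMetric n * B) * (B * B⁻¹) *
            minkowskiMetric n := by
          rw [hgram]
          simp only [mul_assoc]
      _ = minkowskiMetric n := by
          rw [hinv, mul_nonsing_inv B hdet, hηη, one_mul, one_mul]
  · rw [Matrix.IsSymm, transpose_mul, hηt, hsa]
  · rw [mul_assoc, ← mul_assoc (minkowskiMetric n) (minkowskiMetric n), hηη, one_mul, mul_assoc,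
      nonsing_inv_mul B hdet, mul_one]

theorem proposition6 (n : ℕ) (hn : n = 2 ∨ n = 3 ∨ n = 4)
    (M : Matrix (Fin n) (Fin n) ℝ) (hM : IsUnit M) :
    (∃ lam s : Matrix (Fin n) (Fin n) ℝ, IsLorentz lam ∧ s.IsSymm ∧ M = lam * s) ↔
      HasRealSquareRoot (minkowskiMetric n * M.transpose * minkowskiMetric n * M) := by
  constructor
  · rintro ⟨lam, s, hlam, hs, rfl⟩
    refine ⟨minkowskiMetric n * s, ?_⟩
    rw [transpose_mul, hs.eq]
    have hlam' : lamᵀ * minkowskiMetric n * lam = minkowskiMetric n := hlam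
    calc minkowskiMetric n * s * (minkowskiMetric n * s)
        = minkowskiMetric n * s * (lamᵀ * minkowskiMetric n * lam) * s := by
          rw [hlam', ← mul_assoc]
      _ = minkowskiMetric n * (s * lamᵀ) * minkowskiMetric n * (lam * s) := by
          simp only [mul_assoc]
  · rintro ⟨γ, hγ⟩
    obtain ⟨m, rfl⟩ : ∃ m, n = m + 1 := ⟨n - 1, by omega⟩
    obtain ⟨B, hB, hsa⟩ := exists_selfAdjoint_sqrt hM hγ
    exact exists_lorentz_mul_symm hM hB hsa
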